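/- Let $\mathbb{Z}_2$ be the ring of 2-adic integers with absolute value $|\cdot|_2$ and the normalized Haar measure $\mu_2$ on its Borel sets. A map $f\colon\mathbb{Z}_2\to\mathbb{Z}_2$ is a T-function if for every $j\ge 0$ the $j$-th binary digit of $f(x)$ is a Boolean function of the binary digits $0,1,\dots,j$ of $x$. For $m\ge 0$ let $\chi(m,\cdot)$ be the characteristic function of the ball $\{x\in\mathbb{Z}_2 : |x-m|_2\le 2^{-n}\}$, where $n=1$ if $m=0$ and $n=\lfloor\log_2 m\rfloor+1$ otherwise. The map $f$ is ergodic if it preserves $\mu_2$ and every measurable $S$ with $f^{-1}(S)=S$ has measure $0$ or $1$. Let $f\colon\mathbb{Z}_2\to\mathbb{Z}_2$ be a T-function represented by its van der Put series $$f(x)=\sum_{m=0}^{\infty}B_m\,\chi(m,x)\qquad(x\in\mathbb{Z}_2),\qquad B_m\in\mathbb{Z}_2.$$ Then $f$ is ergodic if and only if there is a sequence $a_0,a_1,a_2,\dots$ of 2-adic integers such that $$B_m=\begin{cases} 1+2(a_1-a_0), & m=0;\\ 2(1+a_0+2a_2-a_1), & m=1;\\ 2^{n-1}+2^n a_{m+1}-2^n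 a_m, & 2^{n-1}\le m<2^n-1,\ n\ge 2;\\ 2^{n-1}+2^{n+1}a_{2^n}-2^n a_{2^n-1}-2^n a_{2^{n-1}}, & m=2^n-1,\ n\ge 2. \end{cases}$$ -/

import Mathlib

open MeasureTheory

namespace TwoAdic

/-- The measurable sets of `ℤ_[2]` are the Borel sets, i.e. the sigma-algebra generated by
the balls `a + 2 ^ k ℤ_[2]`. -/
noncomputable instance instMeasurableSpacePadicIntTwo : MeasurableSpace ℤ_[2] :=
  borel ℤ_[2]

instance instBorelSpacePadicIntTwo : BorelSpace ℤ_[2] := ⟨rfl⟩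

/-- The normalized Haar measure on `ℤ_[2]`: the translation-invariant Borel measure for which
the whole (compact) space has measure `1`. -/
noncomputable def haarMeasure : Measure ℤ_[2] :=
  Measure.addHaarMeasure (⊤ : TopologicalSpace.PositiveCompacts ℤ_[2])

/-- The `j`-th digit of the base-2 expansion of a 2-adic integer `x`.
Here `x.appr (j + 1)` is the natural number `< 2 ^ (j + 1)` congruent to `x` modulo
`2 ^ (j + 1)`. -/
noncomputable def digit (x : ℤ_[2]) (j : ℕ) : Bool :=
  (x.appr (j + 1)).testBit j

/-- A (univariate) T-function: there are Boolean coordinate functions `ψ j` in `j + 1` variables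
such that the `j`-th binary digit of `f x` is `ψ j` evaluated at the binary digits
`0, …, j` of `x`. -/
def IsTFunction (f : ℤ_[2] → ℤ_[2]) : Prop :=
  ∃ ψ : (j : ℕ) → (Fin (j + 1) → Bool) → Bool,
    ∀ (x : ℤ_[2]) (j : ℕ), digit (f x) j = ψ j (fun i => digit x i)

open Classical in
/-- The function `χ(m, x)`: the characteristic function of the ball `|x - m| ≤ 2 ^ (-n)`,
where `n = ⌊log₂ m⌋ + 1` is the number of binary digits of `m`
(`n = 1` if `m = 0`, in agreement with `Nat.log 2 0 = 0`). -/
noncomputable def chi (m : ℕ) (x : ℤ_[2]) : ℤ_[2] :=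
  if ‖x - (m : ℤ_[2])‖ ≤ (2 : ℝ) ^ (-((Nat.log 2 m + 1 : ℕ) : ℤ)) then 1 else 0

/-- `B` is the sequence of van der Put coefficients of `f`, i.e. `f` is represented by the
van der Put series `f x = ∑ B m * χ(m, x)`, convergent for every `x`. -/
def IsVanDerPutCoeff (f : ℤ_[2] → ℤ_[2]) (B : ℕ → ℤ_[2]) : Prop :=
  ∀ x : ℤ_[2], HasSum (fun m : ℕ => B m * chi m x) (f x)

end TwoAdic

/-!
A T-function respects congruences modulo every `2 ^ n`, so it acts on each finite quotient
`ℤ / 2 ^ n`. It is ergodic for Haar measure exactly when all these actions are transitive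
(`ergodic_iff_forall_transitiveMod`). If `f` is ergodic, the union of the residue classes met by
an orbit is forward invariant and clopen, hence everything. Conversely, if every action is a
single cycle, `f` permutes the residue classes, which all have the same measure, and an invariant
set has the same share in each of them; it is then independent of every Borel set, itself included.

Transitivity is lifted one digit at a time (`TransitiveMod.succ_iff`). A map that is a single cycle
modulo `2 ^ n` and satisfies `f (m + 2 ^ n) ≡ f m + 2 ^ n` modulo `2 ^ (n + 1)` has a displacement
`f x - x` which, modulo `2 ^ (n + 1)`, depends only on `x` modulo `2 ^ n`. Telescoping over one
turn of the cycle, the `2 ^ n`-th iterate of `f` is translation by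
`∑ m < 2 ^ n, (f m - m)` modulo `2 ^ (n + 1)`, and the cycle lifts to a single cycle exactly when
this sum is `2 ^ n` modulo `2 ^ (n + 1)`.

For an index `m + 2 ^ n` with `m < 2 ^ n` and `n ≥ 1`, the van der Put coefficient is
`f (m + 2 ^ n) - f m`, so the criterion becomes a set of divisibility conditions on the
coefficients (`ergodic_iff_ergodicCoeff`): those of level `n` are `2 ^ n` modulo `2 ^ (n + 1)`, and
the sum of their excesses over `2 ^ n` is divisible by `2 ^ (n + 2)`. The sequence `a` records the
partial sums of the normalized excesses within a level; the condition on the full sum is what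
allows `a (2 ^ (n + 1))` to be solved for.
-/

namespace TwoAdic

/-! ### Congruences modulo powers of two -/

theorem norm_le_iff_pow_dvd (x : ℤ_[2]) (n : ℕ) :
    ‖x‖ ≤ (2 : ℝ) ^ (-(n : ℤ)) ↔ (2 : ℤ_[2]) ^ n ∣ x := by
  have h := PadicInt.norm_le_pow_iff_mem_span_pow (p := 2) x n
  rw [Ideal.mem_span_singleton] at h
  exact_mod_cast h

theorem toZModPow_eq_iff (n : ℕ) (x y : ℤ_[2]) :
    PadicInt.toZModPow (p := 2) n x = PadicInt.toZModPow n y ↔ (2 : ℤ_[2]) ^ n ∣ x - y := by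
  rw [← sub_eq_zero, ← map_sub, ← RingHom.mem_ker, PadicInt.ker_toZModPow,
    Ideal.mem_span_singleton]
  norm_cast

theorem pow_dvd_natCast_sub_iff (n a b : ℕ) :
    (2 : ℤ_[2]) ^ n ∣ (a : ℤ_[2]) - b ↔ a ≡ b [MOD 2 ^ n] := by
  rw [← toZModPow_eq_iff, map_natCast, map_natCast, ZMod.natCast_eq_natCast_iff]

theorem pow_dvd_sub_val (n : ℕ) (x : ℤ_[2]) :
    (2 : ℤ_[2]) ^ n ∣ x - ((PadicInt.toZModPow (p := 2) n x).val : ℕ) := by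
  rw [← toZModPow_eq_iff, map_natCast, ZMod.natCast_zmod_val]

theorem two_dvd_or_two_dvd_sub_one (q : ℤ_[2]) : (2 : ℤ_[2]) ∣ q ∨ (2 : ℤ_[2]) ∣ q - 1 := by
  have h := pow_dvd_sub_val 1 q
  have hlt := ZMod.val_lt (PadicInt.toZModPow (p := 2) 1 q)
  generalize (PadicInt.toZModPow (p := 2) 1 q).val = r at h hlt
  rw [pow_one] at h hlt
  interval_cases r
  · left; simpa using h
  · right; simpa using h

/-- The residue field has two elements: a multiple of `2 ^ n` is `0` or `2 ^ n` modulo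
`2 ^ (n + 1)`. -/
theorem pow_succ_dvd_or {n : ℕ} {d : ℤ_[2]} (h : (2 : ℤ_[2]) ^ n ∣ d) :
    (2 : ℤ_[2]) ^ (n + 1) ∣ d ∨ (2 : ℤ_[2]) ^ (n + 1) ∣ d - 2 ^ n := by
  obtain ⟨q, rfl⟩ := h
  rcases two_dvd_or_two_dvd_sub_one q with hq | hq
  · left; rw [pow_succ]; exact mul_dvd_mul_left _ hq
  · right
    rw [pow_succ, show (2 : ℤ_[2]) ^ n * q - 2 ^ n = 2 ^ n * (q - 1) by ring]
    exact mul_dvd_mul_left _ hq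

theorem not_pow_succ_dvd_pow (n : ℕ) : ¬ (2 : ℤ_[2]) ^ (n + 1) ∣ 2 ^ n := by
  have h := pow_dvd_natCast_sub_iff (n + 1) (2 ^ n) 0
  intro hd
  have := h.1 (by simpa using hd)
  rw [Nat.modEq_zero_iff_dvd] at this
  have := Nat.le_of_dvd (by positivity) this
  have := Nat.pow_lt_pow_right (a := 2) (by norm_num) (Nat.lt_succ_self n)
  omega

/-! ### T-functions are compatible with congruences -/

/-- `f` respects congruences modulo every power of two; equivalently, `f` is `1`-Lipschitz. -/
def Compatible (f : ℤ_[2] → ℤ_[2]) : Prop :=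
  ∀ (n : ℕ) (x y : ℤ_[2]), (2 : ℤ_[2]) ^ n ∣ x - y → (2 : ℤ_[2]) ^ n ∣ f x - f y

theorem appr_mod (x : ℤ_[2]) {j n : ℕ} (h : j ≤ n) : x.appr n % 2 ^ j = x.appr j := by
  have h1 := PadicInt.dvd_appr_sub_appr x j n h
  have h2 : x.appr j ≡ x.appr n [MOD 2 ^ j] :=
    (Nat.modEq_iff_dvd' (PadicInt.appr_mono x h)).2 h1
  rw [← h2, Nat.mod_eq_of_lt (PadicInt.appr_lt x j)]

theorem pow_dvd_sub_iff_appr_eq (n : ℕ) (x y : ℤ_[2]) :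
    (2 : ℤ_[2]) ^ n ∣ x - y ↔ x.appr n = y.appr n := by
  have hx := PadicInt.appr_spec n x
  have hy := PadicInt.appr_spec n y
  rw [Ideal.mem_span_singleton] at hx hy
  norm_num at hx hy
  constructor
  · intro h
    have h1 : (2 : ℤ_[2]) ^ n ∣ (x.appr n : ℤ_[2]) - y.appr n := by
      have := dvd_add (dvd_sub h hx) hy
      convert this using 1; ring
    rw [pow_dvd_natCast_sub_iff] at h1
    exact h1.eq_of_lt_of_lt (PadicInt.appr_lt x n) (PadicInt.appr_lt y n)
  · intro h
    rw [h] at hx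
    convert dvd_sub hx hy using 1; ring

theorem pow_dvd_sub_iff_digit_eq (n : ℕ) (x y : ℤ_[2]) :
    (2 : ℤ_[2]) ^ n ∣ x - y ↔ ∀ j < n, digit x j = digit y j := by
  have key (z : ℤ_[2]) (j : ℕ) (hj : j < n) : (z.appr n).testBit j = digit z j := by
    rw [digit, ← appr_mod z (Nat.succ_le_of_lt hj), Nat.testBit_mod_two_pow]
    simp
  rw [pow_dvd_sub_iff_appr_eq]
  constructor
  · intro h j hj
    rw [← key x j hj, ← key y j hj, h]
  · intro h
    refine Nat.eq_of_testBit_eq fun j => ?_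
    rcases lt_or_ge j n with hj | hj
    · rw [key x j hj, key y j hj, h j hj]
    · have hb (z : ℤ_[2]) : (z.appr n).testBit j = false :=
        Nat.testBit_lt_two_pow
          ((PadicInt.appr_lt z n).trans_le (Nat.pow_le_pow_right (by norm_num) hj))
      rw [hb, hb]

theorem IsTFunction.compatible {f : ℤ_[2] → ℤ_[2]} (hf : IsTFunction f) : Compatible f := by
  obtain ⟨ψ, hψ⟩ := hf
  intro n x y h
  rw [pow_dvd_sub_iff_digit_eq] at h ⊢
  intro j hj
  rw [hψ, hψ]
  congr 1
  funext i
  exact h i (by omega)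

/-! ### Van der Put coefficients -/

theorem chi_natCast (k m : ℕ) :
    chi k (m : ℤ_[2]) = if m ≡ k [MOD 2 ^ (Nat.log 2 k + 1)] then 1 else 0 := by
  unfold chi
  simp only [norm_le_iff_pow_dvd, pow_dvd_natCast_sub_iff]

theorem lt_two_pow_log_succ (k : ℕ) : k < 2 ^ (Nat.log 2 k + 1) :=
  Nat.lt_pow_succ_log_self (by norm_num) k

theorem chi_eq_zero_of_lt {k m : ℕ} (h : m < k) : chi k (m : ℤ_[2]) = 0 := by
  rw [chi_natCast, if_neg]
  intro hm
  exact h.ne (hm.eq_of_lt_of_lt (h.trans (lt_two_pow_log_succ k)) (lt_two_pow_log_succ k))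

theorem chi_self (m : ℕ) : chi m (m : ℤ_[2]) = 1 := by
  rw [chi_natCast, if_pos (Nat.ModEq.refl m)]

section Coefficients

variable {f : ℤ_[2] → ℤ_[2]} {B : ℕ → ℤ_[2]}

theorem IsVanDerPutCoeff.apply_zero (hB : IsVanDerPutCoeff f B) : f 0 = B 0 := by
  refine (hB 0).unique ?_
  convert hasSum_single (f := fun m : ℕ => B m * chi m 0) 0 fun k hk => ?_ using 1
  · have := chi_self 0
    simp_all
  · have := chi_eq_zero_of_lt (Nat.pos_of_ne_zero hk)
    simp_all

theorem IsVanDerPutCoeff.apply_one (hB : IsVanDerPutCoeff f B) : f 1 = B 1 := by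
  refine (hB 1).unique ?_
  convert hasSum_single (f := fun m : ℕ => B m * chi m 1) 1 fun k hk => ?_ using 1
  · have := chi_self 1
    simp_all
  · rcases Nat.lt_or_gt_of_ne hk with h | h
    · obtain rfl : k = 0 := by omega
      have := chi_natCast 0 1
      have h2 : ¬ (1 ≡ 0 [MOD 2 ^ (Nat.log 2 0 + 1)]) := by decide
      rw [if_neg h2] at this
      simp_all
    · have := chi_eq_zero_of_lt h
      simp_all

/-- The coefficient whose index has top binary digit `2 ^ n` is the increment of `f` caused by
that digit. -/
theorem IsVanDerPutCoeff.apply_add_two_pow (hB : IsVanDerPutCoeff f B) {n m : ℕ} (hn : 1 ≤ n)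
    (hm : m < 2 ^ n) : f ((m + 2 ^ n : ℕ) : ℤ_[2]) - f (m : ℤ_[2]) = B (m + 2 ^ n) := by
  refine ((hB ((m + 2 ^ n : ℕ) : ℤ_[2])).sub (hB m)).unique ?_
  have hlt : m < m + 2 ^ n := by have := Nat.two_pow_pos n; omega
  convert hasSum_single (m + 2 ^ n) fun k hk => ?_ using 1
  · rw [chi_self, chi_eq_zero_of_lt hlt]; ring
  · rw [← mul_sub]
    convert mul_zero (B k)
    rw [sub_eq_zero]
    rcases Nat.lt_or_gt_of_ne hk with h | h
    · rcases lt_or_ge k (2 ^ n) with hk2 | hk2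
      · rw [chi_natCast, chi_natCast]
        have hl : Nat.log 2 k + 1 ≤ n := by
          rcases Nat.eq_zero_or_pos k with rfl | hk0
          · simpa using hn
          · exact Nat.log_lt_of_lt_pow hk0.ne' hk2
        have : m + 2 ^ n ≡ m [MOD 2 ^ (Nat.log 2 k + 1)] := by
          have h0 : 2 ^ n ≡ 0 [MOD 2 ^ (Nat.log 2 k + 1)] :=
            (Nat.modEq_zero_iff_dvd).2 (pow_dvd_pow 2 hl)
          simpa using h0.add_left m
        congr 1
        exact propext ⟨fun h => this.symm.trans h, fun h => this.trans h⟩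
      · have hk' : 2 ^ (n + 1) ≤ 2 ^ (Nat.log 2 k + 1) :=
          Nat.pow_le_pow_right (by norm_num)
            (Nat.succ_le_succ (Nat.le_log_of_pow_le (by norm_num) hk2))
        rw [chi_eq_zero_of_lt (hm.trans_le hk2), chi_natCast, if_neg]
        intro hmod
        refine hk (hmod.eq_of_lt_of_lt ?_ (lt_two_pow_log_succ k)).symm
        rw [pow_succ] at hk'
        omega
    · rw [chi_eq_zero_of_lt h, chi_eq_zero_of_lt (hlt.trans h)]

end Coefficients

/-! ### Transitive self-maps of a finite type -/

section Finite

variable {α : Type*} {g : α → α}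

theorem injective_of_transitive [Finite α] (hg : ∀ c d, ∃ k, g^[k] c = d) :
    Function.Injective g := by
  refine Finite.injective_iff_surjective.2 fun d => ?_
  obtain ⟨k, hk⟩ := hg (g d) d
  exact ⟨g^[k] d, by
    rw [← Function.iterate_succ_apply' g, Function.iterate_succ_apply, hk]⟩

theorem image_iterate_range_minimalPeriod [Fintype α] [DecidableEq α]
    (hg : ∀ c d, ∃ k, g^[k] c = d) (c : α) :
    (Finset.range (Function.minimalPeriod g c)).image (fun k => g^[k] c) = Finset.univ := by
  have hp : 0 < Function.minimalPeriod g c := by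
    obtain ⟨k, hk⟩ := hg (g c) c
    exact Function.minimalPeriod_pos_of_mem_periodicPts
      ⟨k + 1, Nat.succ_pos k, by rwa [Function.IsPeriodicPt, Function.IsFixedPt,
        Function.iterate_succ_apply]⟩
  refine Finset.eq_univ_of_forall fun d => ?_
  obtain ⟨k, rfl⟩ := hg c d
  exact Finset.mem_image.2 ⟨k % Function.minimalPeriod g c, Finset.mem_range.2 (Nat.mod_lt _ hp),
    Function.iterate_mod_minimalPeriod_eq⟩

theorem injOn_iterate_range_minimalPeriod (c : α) :
    Set.InjOn (fun k => g^[k] c) (Finset.range (Function.minimalPeriod g c)) := by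
  rw [Finset.coe_range]
  exact Function.iterate_injOn_Iio_minimalPeriod

theorem minimalPeriod_eq_card [Fintype α] (hg : ∀ c d, ∃ k, g^[k] c = d) (c : α) :
    Function.minimalPeriod g c = Fintype.card α := by
  classical
  rw [← Finset.card_univ, ← image_iterate_range_minimalPeriod hg c,
    Finset.card_image_of_injOn (injOn_iterate_range_minimalPeriod c), Finset.card_range]

theorem sum_iterate_eq_sum [Fintype α] {M : Type*} [AddCommMonoid M]
    (hg : ∀ c d, ∃ k, g^[k] c = d) (H : α → M) (c : α) :
    ∑ k ∈ Finset.range (Fintype.card α), H (g^[k] c) = ∑ d, H d := by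
  classical
  rw [← image_iterate_range_minimalPeriod hg c,
    Finset.sum_image (injOn_iterate_range_minimalPeriod c), minimalPeriod_eq_card hg c]

end Finite

/-! ### Transitivity modulo powers of two -/

/-- `f` is transitive modulo `2 ^ n`: every orbit meets every residue class. -/
def TransitiveMod (f : ℤ_[2] → ℤ_[2]) (n : ℕ) : Prop :=
  ∀ x y : ℤ_[2], ∃ k : ℕ, (2 : ℤ_[2]) ^ n ∣ f^[k] x - y

/-- The self-map of `ℤ / 2 ^ n` induced by `f`; it is semiconjugate to `f` by reduction when
`f` is compatible. -/
noncomputable def residueMap (f : ℤ_[2] → ℤ_[2]) (n : ℕ) : ZMod (2 ^ n) → ZMod (2 ^ n) :=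
  fun c => PadicInt.toZModPow n (f (c.val : ℤ_[2]))

/-- The total displacement of `f` over the representatives `0, …, 2 ^ n - 1`. When `f` is
transitive modulo `2 ^ n` and `f x - x` modulo `2 ^ (n + 1)` only depends on `x` modulo `2 ^ n`,
this is the displacement accumulated along one period, taken modulo `2 ^ (n + 1)`. -/
noncomputable def displacement (f : ℤ_[2] → ℤ_[2]) (n : ℕ) : ℤ_[2] :=
  ∑ m ∈ Finset.range (2 ^ n), (f (m : ℤ_[2]) - m)

/-- Adding `2 ^ n` to a representative `m < 2 ^ n` adds `2 ^ n` to `f m`, modulo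
`2 ^ (n + 1)`. -/
def ShiftsTopDigit (f : ℤ_[2] → ℤ_[2]) (n : ℕ) : Prop :=
  ∀ m < 2 ^ n, (2 : ℤ_[2]) ^ (n + 1) ∣ f ((m + 2 ^ n : ℕ) : ℤ_[2]) - f (m : ℤ_[2]) - 2 ^ n

section Transitivity

variable {f : ℤ_[2] → ℤ_[2]} {n : ℕ}

theorem transitiveMod_zero (f : ℤ_[2] → ℤ_[2]) : TransitiveMod f 0 :=
  fun x y => ⟨0, by simp⟩

theorem Compatible.semiconj_residueMap (hf : Compatible f) (n : ℕ) :
    Function.Semiconj (PadicInt.toZModPow (p := 2) n) f (residueMap f n) := by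
  intro x
  rw [residueMap, toZModPow_eq_iff]
  exact hf n _ _ (pow_dvd_sub_val n x)

theorem Compatible.toZModPow_iterate (hf : Compatible f) (n k : ℕ) (x : ℤ_[2]) :
    PadicInt.toZModPow (p := 2) n (f^[k] x)
      = (residueMap f n)^[k] (PadicInt.toZModPow (p := 2) n x) :=
  (hf.semiconj_residueMap n).iterate_right k x

theorem TransitiveMod.residueMap (hf : Compatible f) (h : TransitiveMod f n)
    (c d : ZMod (2 ^ n)) : ∃ k, (residueMap f n)^[k] c = d := by
  obtain ⟨k, hk⟩ := h (c.val : ℤ_[2]) (d.val : ℤ_[2])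
  rw [← toZModPow_eq_iff, hf.toZModPow_iterate] at hk
  simp only [map_natCast, ZMod.natCast_zmod_val] at hk
  exact ⟨k, hk⟩

theorem TransitiveMod.dvd_of_dvd (hf : Compatible f) (h : TransitiveMod f n) {x y : ℤ_[2]}
    (hxy : (2 : ℤ_[2]) ^ n ∣ f x - f y) : (2 : ℤ_[2]) ^ n ∣ x - y := by
  rw [← toZModPow_eq_iff] at hxy ⊢
  rw [hf.semiconj_residueMap n x, hf.semiconj_residueMap n y] at hxy
  exact injective_of_transitive (h.residueMap hf) hxy

theorem TransitiveMod.dvd_iterate_sub (hf : Compatible f) (h : TransitiveMod f n) (x : ℤ_[2]) :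
    (2 : ℤ_[2]) ^ n ∣ f^[2 ^ n] x - x := by
  rw [← toZModPow_eq_iff, hf.toZModPow_iterate]
  have hp := minimalPeriod_eq_card (h.residueMap hf) (PadicInt.toZModPow (p := 2) n x)
  rw [ZMod.card] at hp
  have hper := Function.isPeriodicPt_minimalPeriod (TwoAdic.residueMap f n)
    (PadicInt.toZModPow (p := 2) n x)
  rwa [hp] at hper

/-- Transitivity modulo `2 ^ (n + 1)` prevents an orbit from closing up after `2 ^ n` steps. -/
theorem TransitiveMod.not_dvd_iterate_sub (hf : Compatible f) (h : TransitiveMod f (n + 1))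
    (x : ℤ_[2]) : ¬ (2 : ℤ_[2]) ^ (n + 1) ∣ f^[2 ^ n] x - x := by
  intro hd
  rw [← toZModPow_eq_iff, hf.toZModPow_iterate] at hd
  have hp := minimalPeriod_eq_card (h.residueMap hf) (PadicInt.toZModPow (p := 2) (n + 1) x)
  rw [ZMod.card] at hp
  have hle := Function.IsPeriodicPt.minimalPeriod_le (Nat.two_pow_pos n) hd
  have := Nat.pow_lt_pow_right (a := 2) (by norm_num) (Nat.lt_succ_self n)
  omega

theorem TransitiveMod.shiftsTopDigit (hf : Compatible f) (h : TransitiveMod f (n + 1)) :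
    ShiftsTopDigit f n := by
  intro m _
  have hsub : ((m + 2 ^ n : ℕ) : ℤ_[2]) - m = 2 ^ n := by push_cast; ring
  refine (pow_succ_dvd_or (hf n _ _ (by rw [hsub]))).resolve_left fun hd => ?_
  have := h.dvd_of_dvd hf hd
  rw [hsub] at this
  exact not_pow_succ_dvd_pow n this

/-- Modulo `2 ^ (n + 1)`, the displacement `f x - x` only depends on `x` modulo `2 ^ n`. -/
theorem ShiftsTopDigit.dvd_displacement_sub (hf : Compatible f) (h : ShiftsTopDigit f n)
    (x : ℤ_[2]) :
    (2 : ℤ_[2]) ^ (n + 1) ∣ (f x - x) - (f ((PadicInt.toZModPow (p := 2) n x).val : ℤ_[2])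
      - ((PadicInt.toZModPow (p := 2) n x).val : ℕ)) := by
  have hx := pow_dvd_sub_val n x
  have hlt := ZMod.val_lt (PadicInt.toZModPow (p := 2) n x)
  generalize (PadicInt.toZModPow (p := 2) n x).val = m at hx hlt ⊢
  rcases pow_succ_dvd_or hx with hd | hd
  · convert dvd_sub (hf _ _ _ hd) hd using 1; ring
  · have hd' : (2 : ℤ_[2]) ^ (n + 1) ∣ x - ((m + 2 ^ n : ℕ) : ℤ_[2]) := by
      convert hd using 1; push_cast; ring
    convert dvd_sub (dvd_add (hf _ _ _ hd') (h m hlt)) hd using 1; ring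

theorem sum_zmod_eq_sum_range {M : Type*} [AddCommMonoid M] (N : ℕ) [NeZero N] (F : ℕ → M) :
    ∑ c : ZMod N, F c.val = ∑ m ∈ Finset.range N, F m := by
  refine Finset.sum_bij (fun c _ => c.val) (fun c _ => Finset.mem_range.2 (ZMod.val_lt c))
    (fun c _ d _ h => ZMod.val_injective N h) (fun m hm => ⟨(m : ZMod N), Finset.mem_univ _, ?_⟩)
    (fun c _ => rfl)
  exact ZMod.val_cast_of_lt (Finset.mem_range.1 hm)

/-- Telescoping along one period of a map that is transitive modulo `2 ^ n`. -/
theorem TransitiveMod.dvd_iterate_sub_displacement (hf : Compatible f) (h : TransitiveMod f n)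
    (hs : ShiftsTopDigit f n) (x : ℤ_[2]) :
    (2 : ℤ_[2]) ^ (n + 1) ∣ (f^[2 ^ n] x - x) - displacement f n := by
  have htel : f^[2 ^ n] x - x = ∑ k ∈ Finset.range (2 ^ n), (f (f^[k] x) - f^[k] x) := by
    have := Finset.sum_range_sub (fun k => f^[k] x) (2 ^ n)
    simpa [Function.iterate_succ_apply'] using this.symm
  have hsum := sum_iterate_eq_sum (h.residueMap hf)
    (fun c : ZMod (2 ^ n) => f (c.val : ℤ_[2]) - (c.val : ℤ_[2]))
    (PadicInt.toZModPow (p := 2) n x)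
  rw [ZMod.card, sum_zmod_eq_sum_range (2 ^ n) fun m => f (m : ℤ_[2]) - (m : ℤ_[2])] at hsum
  rw [htel, displacement, ← hsum, ← Finset.sum_sub_distrib]
  refine Finset.dvd_sum fun k _ => ?_
  rw [← hf.toZModPow_iterate]
  exact hs.dvd_displacement_sub hf _

/-- A cycle modulo `2 ^ n` lifts to a single cycle modulo `2 ^ (n + 1)` exactly when one turn
around it flips the top digit. -/
theorem TransitiveMod.succ_iff (hf : Compatible f) (h : TransitiveMod f n)
    (hs : ShiftsTopDigit f n) :
    TransitiveMod f (n + 1) ↔ (2 : ℤ_[2]) ^ (n + 1) ∣ displacement f n - 2 ^ n := by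
  have key := h.dvd_iterate_sub_displacement hf hs
  constructor
  · intro h'
    have h1 := (pow_succ_dvd_or (h.dvd_iterate_sub hf 0)).resolve_left
      (h'.not_dvd_iterate_sub hf 0)
    convert dvd_sub h1 (key 0) using 1; ring
  · intro hd x y
    obtain ⟨k, hk⟩ := h x y
    rcases pow_succ_dvd_or hk with h0 | h0
    · exact ⟨k, h0⟩
    · refine ⟨2 ^ n + k, ?_⟩
      rw [Function.iterate_add_apply]
      -- Both the defect of `f^[k] x` and the effect of a full turn equal `2 ^ n`.
      have h2 : (2 : ℤ_[2]) ^ (n + 1) ∣ 2 ^ n + 2 ^ n := by rw [pow_succ, mul_two]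
      convert dvd_add (dvd_add (dvd_add (key (f^[k] x)) hd) h0) h2 using 1; ring

theorem forall_transitiveMod_iff (hf : Compatible f) :
    (∀ n, TransitiveMod f n) ↔
      ∀ n, ShiftsTopDigit f n ∧ (2 : ℤ_[2]) ^ (n + 1) ∣ displacement f n - 2 ^ n := by
  constructor
  · intro h n
    have hs := (h (n + 1)).shiftsTopDigit hf
    exact ⟨hs, ((h n).succ_iff hf hs).1 (h (n + 1))⟩
  · intro h n
    induction n with
    | zero => exact transitiveMod_zero f
    | succ n ih => exact (ih.succ_iff hf (h n).1).2 (h n).2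

end Transitivity

/-! ### Haar measure and residue classes -/

/-- The residue class of `a` modulo `2 ^ n`, i.e. the closed ball of radius `2 ^ (-n)`. -/
def residueClass (n : ℕ) (a : ℤ_[2]) : Set ℤ_[2] := {x | (2 : ℤ_[2]) ^ n ∣ x - a}

theorem mem_residueClass {n : ℕ} {a x : ℤ_[2]} :
    x ∈ residueClass n a ↔ (2 : ℤ_[2]) ^ n ∣ x - a := Iff.rfl

theorem mem_residueClass_self (n : ℕ) (a : ℤ_[2]) : a ∈ residueClass n a := by
  simp [mem_residueClass]

theorem residueClass_eq_closedBall (n : ℕ) (a : ℤ_[2]) :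
    residueClass n a = Metric.closedBall a ((2 : ℝ) ^ (-(n : ℤ))) := by
  ext x
  rw [mem_residueClass, Metric.mem_closedBall, dist_eq_norm, norm_le_iff_pow_dvd]

theorem isOpen_residueClass (n : ℕ) (a : ℤ_[2]) : IsOpen (residueClass n a) := by
  rw [residueClass_eq_closedBall]
  exact IsUltrametricDist.isOpen_closedBall a (by positivity)

theorem residueClass_subset {n k : ℕ} (hnk : n ≤ k) {a b x : ℤ_[2]} (ha : x ∈ residueClass n a)
    (hb : x ∈ residueClass k b) : residueClass k b ⊆ residueClass n a := by
  intro y hy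
  rw [mem_residueClass] at *
  convert dvd_add (dvd_sub ((pow_dvd_pow 2 hnk).trans hy) ((pow_dvd_pow 2 hnk).trans hb)) ha
    using 1
  ring

theorem residueClass_eq {n : ℕ} {a b : ℤ_[2]} (h : (2 : ℤ_[2]) ^ n ∣ a - b) :
    residueClass n a = residueClass n b :=
  (residueClass_subset le_rfl h (mem_residueClass_self n a)).antisymm
    (residueClass_subset le_rfl (mem_residueClass_self n a) h)

theorem residueClass_eq_preimage (n : ℕ) (c : ZMod (2 ^ n)) :
    residueClass n (c.val : ℤ_[2]) = PadicInt.toZModPow (p := 2) n ⁻¹' {c} := by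
  ext x
  rw [mem_residueClass, ← toZModPow_eq_iff, map_natCast, ZMod.natCast_zmod_val]
  rfl

theorem exists_residueClass_subset {U : Set ℤ_[2]} (hU : IsOpen U) {a : ℤ_[2]} (ha : a ∈ U) :
    ∃ n, residueClass n a ⊆ U := by
  obtain ⟨ε, hε, hsub⟩ := Metric.isOpen_iff.1 hU a ha
  obtain ⟨n, hn⟩ := exists_pow_lt_of_lt_one hε (by norm_num : (1 / 2 : ℝ) < 1)
  refine ⟨n, fun x hx => hsub ?_⟩
  rw [residueClass_eq_closedBall, Metric.mem_closedBall] at hx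
  rw [Metric.mem_ball]
  refine hx.trans_lt ?_
  rw [zpow_neg, zpow_natCast]
  simpa using hn

/-- A finite measure on `ℤ_[2]` is determined by its values on residue classes. -/
theorem measure_ext_residueClass {μ ν : Measure ℤ_[2]} [IsFiniteMeasure μ]
    (h : ∀ n a, μ (residueClass n a) = ν (residueClass n a)) : μ = ν := by
  have hbasis : TopologicalSpace.IsTopologicalBasis
      {s : Set ℤ_[2] | ∃ n a, s = residueClass n a} := by
    refine TopologicalSpace.isTopologicalBasis_of_isOpen_of_nhds ?_ fun a U ha hU => ?_
    · rintro _ ⟨n, a, rfl⟩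
      exact isOpen_residueClass n a
    · obtain ⟨n, hn⟩ := exists_residueClass_subset hU ha
      exact ⟨_, ⟨n, a, rfl⟩, mem_residueClass_self n a, hn⟩
  have huniv : residueClass 0 0 = Set.univ := by
    ext x; simp [mem_residueClass]
  refine ext_of_generate_finite {s : Set ℤ_[2] | ∃ n a, s = residueClass n a}
    hbasis.borel_eq_generateFrom ?_ ?_ ?_
  · rintro _ ⟨n, a, rfl⟩ _ ⟨k, b, rfl⟩ ⟨x, hxa, hxb⟩
    rcases le_total n k with hnk | hnk
    · exact ⟨k, b, Set.inter_eq_right.2 (residueClass_subset hnk hxa hxb)⟩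
    · exact ⟨n, a, Set.inter_eq_left.2 (residueClass_subset hnk hxb hxa)⟩
  · rintro _ ⟨n, a, rfl⟩
    exact h n a
  · rw [← huniv]; exact h 0 0

instance : haarMeasure.IsAddHaarMeasure := by
  unfold haarMeasure; infer_instance

instance : IsProbabilityMeasure haarMeasure := by
  refine ⟨?_⟩
  have := Measure.addHaarMeasure_self (K₀ := (⊤ : TopologicalSpace.PositiveCompacts ℤ_[2]))
  simpa [haarMeasure] using this

theorem haarMeasure_residueClass (n : ℕ) (a b : ℤ_[2]) :
    haarMeasure (residueClass n a) = haarMeasure (residueClass n b) := by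
  rw [← measure_preimage_add haarMeasure (b - a) (residueClass n b)]
  congr 1
  ext x
  rw [Set.mem_preimage, mem_residueClass, mem_residueClass]
  ring_nf

theorem measure_eq_sum_residueClass (μ : Measure ℤ_[2]) (n : ℕ) (S : Set ℤ_[2]) :
    μ S = ∑ c : ZMod (2 ^ n), μ (S ∩ residueClass n (c.val : ℤ_[2])) := by
  have hm (c : ZMod (2 ^ n)) :
      MeasurableSet (PadicInt.toZModPow (p := 2) n ⁻¹' {c}) := by
    rw [← residueClass_eq_preimage]
    exact (isOpen_residueClass n _).measurableSet
  simp_rw [residueClass_eq_preimage]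
  have h := sum_measure_preimage_singleton (μ := μ.restrict S)
    (f := PadicInt.toZModPow (p := 2) n) Finset.univ fun c _ => hm c
  simp_rw [Measure.restrict_apply (hm _)] at h
  simpa [Set.inter_comm] using h.symm

/-! ### Ergodicity and transitivity modulo powers of two -/

section Ergodic

variable {f : ℤ_[2] → ℤ_[2]}

theorem Compatible.continuous (hf : Compatible f) : Continuous f := by
  refine continuous_iff_continuousAt.2 fun x s hs => ?_
  obtain ⟨U, hUs, hU, hxU⟩ := mem_nhds_iff.1 hs
  obtain ⟨n, hn⟩ := exists_residueClass_subset hU hxU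
  refine Filter.mem_map.2 (Filter.mem_of_superset
    ((isOpen_residueClass n x).mem_nhds (mem_residueClass_self n x)) fun y hy => ?_)
  exact hUs (hn (mem_residueClass.2 (hf n y x hy)))

/-- The residue classes met by one orbit form a forward invariant clopen set. By ergodicity its
complement is an open null set, hence empty. -/
theorem transitiveMod_of_ergodic (hf : Compatible f) (he : Ergodic f haarMeasure) (n : ℕ) :
    TransitiveMod f n := by
  intro x
  by_contra! hne
  obtain ⟨y, hy⟩ := hne
  have hopen : IsOpen (⋃ k : ℕ, residueClass n (f^[k] x)) :=
    isOpen_iUnion fun k => isOpen_residueClass n _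
  have hinv : (⋃ k : ℕ, residueClass n (f^[k] x)) ⊆
      f ⁻¹' (⋃ k : ℕ, residueClass n (f^[k] x)) := by
    refine Set.iUnion_subset fun k z hz => Set.mem_iUnion.2 ⟨k + 1, ?_⟩
    rw [Function.iterate_succ_apply']
    exact hf n _ _ hz
  have hdisj : residueClass n y ⊆ (⋃ k : ℕ, residueClass n (f^[k] x))ᶜ := by
    intro z hz hz'
    obtain ⟨k, hk⟩ := Set.mem_iUnion.1 hz'
    refine hy k ?_
    convert dvd_sub (mem_residueClass.1 hz) (mem_residueClass.1 hk) using 1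
    ring
  rcases he.ae_empty_or_univ_of_ae_le_preimage hopen.measurableSet.nullMeasurableSet
    hinv.eventuallyLE with h | h
  · exact (hopen.measure_pos haarMeasure
      ⟨x, Set.mem_iUnion.2 ⟨0, mem_residueClass_self n x⟩⟩).ne' (ae_eq_empty.1 h)
  · exact ((isOpen_residueClass n y).measure_pos haarMeasure ⟨y, mem_residueClass_self n y⟩).ne'
      (measure_mono_null hdisj (ae_eq_univ.1 h))

theorem preimage_residueClass (hf : Compatible f) {n : ℕ} (h : TransitiveMod f n) (x : ℤ_[2]) :
    f ⁻¹' residueClass n (f x) = residueClass n x :=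
  Set.Subset.antisymm (fun _ hy => h.dvd_of_dvd hf hy) fun y hy => hf n y x hy

theorem exists_preimage_residueClass (hf : Compatible f) {n : ℕ} (h : TransitiveMod f n)
    (y : ℤ_[2]) : ∃ x, f ⁻¹' residueClass n y = residueClass n x := by
  obtain ⟨k, hk⟩ := h (f y) y
  rw [← Function.iterate_succ_apply, Function.iterate_succ_apply'] at hk
  exact ⟨f^[k] y, by rw [← residueClass_eq hk, preimage_residueClass hf h]⟩

theorem measurePreserving_of_transitiveMod (hf : Compatible f) (h : ∀ n, TransitiveMod f n) :
    MeasurePreserving f haarMeasure haarMeasure := by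
  have hfm : Measurable f := hf.continuous.measurable
  have := Measure.isProbabilityMeasure_map (μ := haarMeasure) hfm.aemeasurable
  refine ⟨hfm, measure_ext_residueClass fun n a => ?_⟩
  obtain ⟨x, hx⟩ := exists_preimage_residueClass hf (h n) a
  rw [Measure.map_apply hfm (isOpen_residueClass n a).measurableSet, hx]
  exact haarMeasure_residueClass n x a

/-- An invariant set occupies the same share of every residue class modulo `2 ^ n`, since `f`
permutes these classes cyclically; so it is independent of all residue classes. -/
theorem haarMeasure_inter_residueClass (hf : Compatible f) (h : ∀ n, TransitiveMod f n)
    {S : Set ℤ_[2]} (hS : MeasurableSet S) (hSf : f ⁻¹' S = S) (n : ℕ) (a : ℤ_[2]) :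
    haarMeasure (S ∩ residueClass n a) = haarMeasure S * haarMeasure (residueClass n a) := by
  have hmp := measurePreserving_of_transitiveMod hf h
  have hstep (x : ℤ_[2]) :
      haarMeasure (S ∩ residueClass n (f x)) = haarMeasure (S ∩ residueClass n x) := by
    rw [← hmp.measure_preimage
      (hS.inter (isOpen_residueClass n (f x)).measurableSet).nullMeasurableSet,
      Set.preimage_inter, hSf, preimage_residueClass hf (h n)]
  have hiter (k : ℕ) (x : ℤ_[2]) :
      haarMeasure (S ∩ residueClass n (f^[k] x)) = haarMeasure (S ∩ residueClass n x) := by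
    induction k with
    | zero => rfl
    | succ k ih => rw [Function.iterate_succ_apply', hstep, ih]
  have hconst (x : ℤ_[2]) :
      haarMeasure (S ∩ residueClass n x) = haarMeasure (S ∩ residueClass n a) := by
    obtain ⟨k, hk⟩ := h n a x
    rw [← residueClass_eq hk, hiter]
  have h1 := measure_eq_sum_residueClass haarMeasure n S
  have h2 := measure_eq_sum_residueClass haarMeasure n Set.univ
  simp_rw [Set.univ_inter, haarMeasure_residueClass n _ a] at h2
  simp_rw [hconst] at h1
  rw [Finset.sum_const, nsmul_eq_mul] at h1 h2
  rw [measure_univ] at h2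
  rw [h1, mul_right_comm, ← h2, one_mul]

theorem ergodic_of_transitiveMod (hf : Compatible f) (h : ∀ n, TransitiveMod f n) :
    Ergodic f haarMeasure := by
  refine ⟨measurePreserving_of_transitiveMod hf h, ⟨fun S hS hSf => ?_⟩⟩
  have hres : haarMeasure.restrict S = haarMeasure S • haarMeasure := by
    refine measure_ext_residueClass fun n a => ?_
    rw [Measure.restrict_apply (isOpen_residueClass n a).measurableSet, Set.inter_comm,
      haarMeasure_inter_residueClass hf h hS hSf]
    rfl
  -- Evaluating both measures at `Sᶜ` shows that `S` is independent of itself.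
  have hprod : haarMeasure S * haarMeasure Sᶜ = 0 := by
    have := congrArg (fun μ : Measure ℤ_[2] => μ Sᶜ) hres
    simpa [Measure.restrict_apply hS.compl] using this.symm
  rw [Filter.eventuallyConst_set']
  rcases mul_eq_zero.1 hprod with h0 | h0
  · exact Or.inl (ae_eq_empty.2 h0)
  · exact Or.inr (ae_eq_univ.2 h0)

theorem ergodic_iff_forall_transitiveMod (hf : Compatible f) :
    Ergodic f haarMeasure ↔ ∀ n, TransitiveMod f n :=
  ⟨transitiveMod_of_ergodic hf, ergodic_of_transitiveMod hf⟩

end Ergodic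

/-! ### The criterion in terms of van der Put coefficients -/

/-- Divisibility conditions on the van der Put coefficients that characterize ergodicity. -/
def ErgodicCoeff (B : ℕ → ℤ_[2]) : Prop :=
  2 ∣ B 0 - 1 ∧ 4 ∣ B 0 + B 1 - 3 ∧ ∀ n, 1 ≤ n →
    (∀ m < 2 ^ n, (2 : ℤ_[2]) ^ (n + 1) ∣ B (m + 2 ^ n) - 2 ^ n) ∧
      (2 : ℤ_[2]) ^ (n + 2) ∣ ∑ m ∈ Finset.range (2 ^ n), (B (m + 2 ^ n) - 2 ^ n)

section Criterion

variable {f : ℤ_[2] → ℤ_[2]} {B : ℕ → ℤ_[2]}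

theorem displacement_zero (f : ℤ_[2] → ℤ_[2]) : displacement f 0 = f 0 := by
  simp [displacement]

theorem displacement_succ (f : ℤ_[2] → ℤ_[2]) (n : ℕ) :
    displacement f (n + 1) = 2 * displacement f n +
      ∑ m ∈ Finset.range (2 ^ n), (f ((m + 2 ^ n : ℕ) : ℤ_[2]) - f (m : ℤ_[2]) - 2 ^ n) := by
  unfold displacement
  rw [pow_succ, mul_two, Finset.sum_range_add, two_mul]
  simp only [← Finset.sum_add_distrib]
  refine Finset.sum_congr rfl fun m _ => ?_
  rw [add_comm (2 ^ n) m]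
  push_cast
  ring

theorem IsVanDerPutCoeff.displacement_one (hB : IsVanDerPutCoeff f B) :
    displacement f 1 = B 0 + B 1 - 1 := by
  rw [displacement_succ f 0, displacement_zero]
  simp [hB.apply_zero, hB.apply_one]
  ring

theorem IsVanDerPutCoeff.displacement_succ (hB : IsVanDerPutCoeff f B) {n : ℕ} (hn : 1 ≤ n) :
    displacement f (n + 1) = 2 * displacement f n +
      ∑ m ∈ Finset.range (2 ^ n), (B (m + 2 ^ n) - 2 ^ n) := by
  rw [TwoAdic.displacement_succ]
  congr 1
  refine Finset.sum_congr rfl fun m hm => ?_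
  rw [hB.apply_add_two_pow hn (Finset.mem_range.1 hm)]

/-- The doubling rule for the displacement makes the top-digit condition at level `n + 1`
equivalent to a condition on the coefficients of level `n`, given the condition at level `n`. -/
theorem IsVanDerPutCoeff.displacement_succ_iff (hB : IsVanDerPutCoeff f B) {n : ℕ} (hn : 1 ≤ n)
    (h : (2 : ℤ_[2]) ^ (n + 1) ∣ displacement f n - 2 ^ n) :
    (2 : ℤ_[2]) ^ (n + 2) ∣ displacement f (n + 1) - 2 ^ (n + 1) ↔
      (2 : ℤ_[2]) ^ (n + 2) ∣ ∑ m ∈ Finset.range (2 ^ n), (B (m + 2 ^ n) - 2 ^ n) := by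
  have h2 : (2 : ℤ_[2]) ^ (n + 2) ∣ 2 * (displacement f n - 2 ^ n) := by
    rw [pow_succ' 2 (n + 1)]
    exact mul_dvd_mul_left 2 h
  have heq : displacement f (n + 1) - 2 ^ (n + 1) = 2 * (displacement f n - 2 ^ n) +
      ∑ m ∈ Finset.range (2 ^ n), (B (m + 2 ^ n) - 2 ^ n) := by
    rw [hB.displacement_succ hn]
    ring
  rw [heq, dvd_add_right h2]

theorem forall_shiftsTopDigit_iff_ergodicCoeff (hB : IsVanDerPutCoeff f B) :
    (∀ n, ShiftsTopDigit f n ∧ (2 : ℤ_[2]) ^ (n + 1) ∣ displacement f n - 2 ^ n) ↔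
      ErgodicCoeff B := by
  constructor
  · intro h
    refine ⟨?_, ?_, fun n hn => ⟨fun m hm => ?_, ?_⟩⟩
    · simpa [displacement_zero, hB.apply_zero] using (h 0).2
    · have := (h 1).2
      rw [hB.displacement_one] at this
      convert this using 1 <;> norm_num
      ring
    · rw [← hB.apply_add_two_pow hn hm]
      exact (h n).1 m hm
    · exact (hB.displacement_succ_iff hn (h n).2).1 (h (n + 1)).2
  · rintro ⟨h0, h1, h⟩
    have hd1 : (2 : ℤ_[2]) ^ (1 + 1) ∣ displacement f 1 - 2 ^ 1 := by
      rw [hB.displacement_one]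
      convert h1 using 1 <;> norm_num
      ring
    have hd (n : ℕ) (hn : 1 ≤ n) : (2 : ℤ_[2]) ^ (n + 1) ∣ displacement f n - 2 ^ n := by
      induction n, hn using Nat.le_induction with
      | base => exact hd1
      | succ n hn ih => exact (hB.displacement_succ_iff hn ih).2 (h n hn).2
    intro n
    rcases Nat.eq_zero_or_pos n with rfl | hn
    · refine ⟨fun m hm => ?_, ?_⟩
      · obtain rfl : m = 0 := by simpa using hm
        have h2 : (2 : ℤ_[2]) ∣ B 0 + B 1 - 3 := Dvd.dvd.trans ⟨2, by norm_num⟩ h1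
        have h3 : (2 : ℤ_[2]) ∣ B 1 - B 0 - 1 := by
          convert dvd_sub h2 (dvd_mul_right 2 (B 0 - 1)) using 1
          ring
        simpa [hB.apply_zero, hB.apply_one] using h3
      · simpa [displacement_zero, hB.apply_zero] using h0
    · refine ⟨fun m hm => ?_, hd n hn⟩
      rw [hB.apply_add_two_pow hn hm]
      exact (h n hn).1 m hm

theorem ergodic_iff_ergodicCoeff (hf : IsTFunction f) (hB : IsVanDerPutCoeff f B) :
    Ergodic f haarMeasure ↔ ErgodicCoeff B := by
  rw [ergodic_iff_forall_transitiveMod hf.compatible, forall_transitiveMod_iff hf.compatible,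
    forall_shiftsTopDigit_iff_ergodicCoeff hB]

end Criterion

/-! ### Solving for the parametrizing sequence -/

/-- `B` is given by the sequence `a`. The coefficients of level `n`, i.e. those with index in
`[2 ^ n, 2 ^ (n + 1))`, are indexed by their offset `i` from `2 ^ n`. -/
def IsParametrizedBy (B a : ℕ → ℤ_[2]) : Prop :=
  B 0 = 1 + 2 * (a 1 - a 0) ∧ B 1 = 2 * (1 + a 0 + 2 * a 2 - a 1) ∧ ∀ n, 1 ≤ n →
    (∀ i, i + 1 < 2 ^ n →
      B (i + 2 ^ n) = 2 ^ n + 2 ^ (n + 1) * (a (i + 1 + 2 ^ n) - a (i + 2 ^ n))) ∧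
    B (2 ^ n - 1 + 2 ^ n) = 2 ^ n + 2 ^ (n + 1) *
      (2 * a (2 ^ (n + 1)) - a (2 ^ n - 1 + 2 ^ n) - a (2 ^ n))

theorem IsParametrizedBy.ergodicCoeff {B a : ℕ → ℤ_[2]} (h : IsParametrizedBy B a) :
    ErgodicCoeff B := by
  obtain ⟨h0, h1, h⟩ := h
  refine ⟨⟨a 1 - a 0, by rw [h0]; ring⟩, ⟨a 2, by rw [h0, h1]; ring⟩, fun n hn => ?_⟩
  obtain ⟨hlow, hlast⟩ := h n hn
  have hpos : 2 ^ n - 1 + 1 = 2 ^ n := Nat.sub_add_cancel (Nat.one_le_two_pow)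
  refine ⟨fun m hm => ?_, ?_⟩
  · rcases Nat.lt_or_ge (m + 1) (2 ^ n) with hm' | hm'
    · rw [hlow m hm', add_sub_cancel_left]
      exact dvd_mul_right _ _
    · obtain rfl : m = 2 ^ n - 1 := by omega
      rw [hlast, add_sub_cancel_left]
      exact dvd_mul_right _ _
  · refine ⟨a (2 ^ (n + 1)) - a (2 ^ n), ?_⟩
    have htel := Finset.sum_range_sub (fun i => a (i + 2 ^ n)) (2 ^ n - 1)
    have hsum : ∑ i ∈ Finset.range (2 ^ n - 1), (B (i + 2 ^ n) - 2 ^ n)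
        = 2 ^ (n + 1) * (a (2 ^ n - 1 + 2 ^ n) - a (2 ^ n)) := by
      rw [zero_add] at htel
      rw [← htel, Finset.mul_sum]
      refine Finset.sum_congr rfl fun i hi => ?_
      rw [hlow i (by have := Finset.mem_range.1 hi; omega)]
      ring
    rw [← hpos, Finset.sum_range_succ, hpos, hsum, hlast]
    ring

/-- The sequence is obtained by summing the normalized coefficients `c n i` within each level,
starting from the value `b n` at `2 ^ n`; the condition on the sum over a level says exactly that
`b (n + 1)` can be solved for. -/
theorem ErgodicCoeff.exists_isParametrizedBy {B : ℕ → ℤ_[2]} (h : ErgodicCoeff B) :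
    ∃ a, IsParametrizedBy B a := by
  obtain ⟨⟨p, hp⟩, ⟨q, hq⟩, h⟩ := h
  have hc (n i : ℕ) : ∃ c : ℤ_[2], 1 ≤ n → i < 2 ^ n →
      B (i + 2 ^ n) - 2 ^ n = 2 ^ (n + 1) * c := by
    by_cases hn : 1 ≤ n ∧ i < 2 ^ n
    · obtain ⟨c, hc⟩ := (h n hn.1).1 i hn.2
      exact ⟨c, fun _ _ => hc⟩
    · exact ⟨0, fun h1 h2 => absurd ⟨h1, h2⟩ hn⟩
  choose c hc using hc
  have hs (n : ℕ) : ∃ s : ℤ_[2], 1 ≤ n → ∑ i ∈ Finset.range (2 ^ n), c n i = 2 * s := by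
    by_cases hn : 1 ≤ n
    · obtain ⟨s, hs⟩ := (h n hn).2
      refine ⟨s, fun _ => ?_⟩
      rw [Finset.sum_congr rfl fun i hi => hc n i hn (Finset.mem_range.1 hi),
        ← Finset.mul_sum] at hs
      refine mul_left_cancel₀ (pow_ne_zero (n + 1) (two_ne_zero' ℤ_[2])) ?_
      rw [hs]
      ring
    · exact ⟨0, fun h1 => absurd h1 hn⟩
  choose s hs using hs
  let b : ℕ → ℤ_[2] := fun n => Nat.rec p (fun n y => if n = 0 then q else y + s n) n
  have hb1 : b 1 = q := rfl
  have hb (n : ℕ) (hn : 1 ≤ n) : b (n + 1) = b n + s n := if_neg (by omega)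
  let a : ℕ → ℤ_[2] := fun m => if m = 0 then 0 else
    b (Nat.log 2 m) + ∑ i ∈ Finset.range (m - 2 ^ Nat.log 2 m), c (Nat.log 2 m) i
  have ha (n i : ℕ) (hi : i < 2 ^ n) :
      a (i + 2 ^ n) = b n + ∑ j ∈ Finset.range i, c n j := by
    have hlog : Nat.log 2 (i + 2 ^ n) = n :=
      (Nat.log_eq_iff (Or.inr ⟨by norm_num, by have := Nat.two_pow_pos n; omega⟩)).2
        ⟨by omega, by rw [pow_succ]; omega⟩
    have hne : i + 2 ^ n ≠ 0 := by have := Nat.two_pow_pos n; omega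
    simp only [a, if_neg hne, hlog, Nat.add_sub_cancel]
  have ha' (n : ℕ) : a (2 ^ n) = b n := by
    simpa using ha n 0 (Nat.two_pow_pos n)
  have ha0 : a 0 = 0 := if_pos rfl
  have ha1 : a 1 = p := ha' 0
  have ha2 : a 2 = q := (ha' 1).trans hb1
  refine ⟨a, ?_, ?_, fun n hn => ⟨fun i hi => ?_, ?_⟩⟩
  · rw [ha0, ha1]
    linear_combination hp
  · rw [ha0, ha1, ha2]
    linear_combination hq - hp
  · rw [ha n i (by omega), ha n (i + 1) hi, Finset.sum_range_succ]
    linear_combination hc n i hn (by omega)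
  · have hpos : 2 ^ n - 1 + 1 = 2 ^ n := Nat.sub_add_cancel (Nat.one_le_two_pow)
    have hsn := hs n hn
    rw [← hpos, Finset.sum_range_succ] at hsn
    rw [ha n _ (by omega), ha', ha', hb n hn]
    linear_combination hc n (2 ^ n - 1) hn (by omega) + 2 ^ (n + 1) * hsn

theorem isParametrizedBy_iff (B a : ℕ → ℤ_[2]) :
    IsParametrizedBy B a ↔
      B 0 = 1 + 2 * (a 1 - a 0) ∧
      B 1 = 2 * (1 + a 0 + 2 * a 2 - a 1) ∧
      (∀ n : ℕ, 2 ≤ n → ∀ m : ℕ, 2 ^ (n - 1) ≤ m → m < 2 ^ n - 1 →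
        B m = 2 ^ (n - 1) + 2 ^ n * a (m + 1) - 2 ^ n * a m) ∧
      (∀ n : ℕ, 2 ≤ n →
        B (2 ^ n - 1) =
          2 ^ (n - 1) + 2 ^ (n + 1) * a (2 ^ n) - 2 ^ n * a (2 ^ n - 1)
            - 2 ^ n * a (2 ^ (n - 1))) := by
  have hlast (n : ℕ) : 2 ^ (n + 1) - 1 = 2 ^ n - 1 + 2 ^ n := by
    have := Nat.one_le_two_pow (n := n)
    rw [pow_succ]; omega
  constructor
  · rintro ⟨h0, h1, h⟩
    refine ⟨h0, h1, fun n hn m hm hm' => ?_, fun n hn => ?_⟩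
    · obtain ⟨n, rfl⟩ : ∃ k, n = k + 1 := ⟨n - 1, by omega⟩
      rw [hlast] at hm'
      rw [Nat.add_sub_cancel] at hm ⊢
      obtain ⟨i, rfl⟩ : ∃ i, m = i + 2 ^ n := ⟨m - 2 ^ n, by omega⟩
      rw [(h n (by omega)).1 i (by omega), show i + 2 ^ n + 1 = i + 1 + 2 ^ n by ring]
      ring
    · obtain ⟨n, rfl⟩ : ∃ k, n = k + 1 := ⟨n - 1, by omega⟩
      rw [hlast, Nat.add_sub_cancel, (h n (by omega)).2]
      ring
  · rintro ⟨h0, h1, h2, h3⟩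
    refine ⟨h0, h1, fun n hn => ⟨fun i hi => ?_, ?_⟩⟩
    · have := h2 (n + 1) (by omega) (i + 2 ^ n) (by rw [Nat.add_sub_cancel]; omega)
        (by rw [hlast]; omega)
      rw [Nat.add_sub_cancel, show i + 2 ^ n + 1 = i + 1 + 2 ^ n by ring] at this
      rw [this]
      ring
    · have := h3 (n + 1) (by omega)
      rw [hlast, Nat.add_sub_cancel] at this
      rw [this]
      ring

end TwoAdic

theorem lemma3p6 (f : ℤ_[2] → ℤ_[2]) (hf : TwoAdic.IsTFunction f)
    (B : ℕ → ℤ_[2]) (hB : TwoAdic.IsVanDerPutCoeff f B) :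
    Ergodic f TwoAdic.haarMeasure ↔
      ∃ a : ℕ → ℤ_[2],
        B 0 = 1 + 2 * (a 1 - a 0) ∧
        B 1 = 2 * (1 + a 0 + 2 * a 2 - a 1) ∧
        (∀ n : ℕ, 2 ≤ n → ∀ m : ℕ, 2 ^ (n - 1) ≤ m → m < 2 ^ n - 1 →
          B m = 2 ^ (n - 1) + 2 ^ n * a (m + 1) - 2 ^ n * a m) ∧
        (∀ n : ℕ, 2 ≤ n →
          B (2 ^ n - 1) =
            2 ^ (n - 1) + 2 ^ (n + 1) * a (2 ^ n) - 2 ^ n * a (2 ^ n - 1)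
              - 2 ^ n * a (2 ^ (n - 1))) := by
  simp only [← TwoAdic.isParametrizedBy_iff]
  exact (TwoAdic.ergodic_iff_ergodicCoeff hf hB).trans
    ⟨fun h => h.exists_isParametrizedBy, fun ⟨_, ha⟩ => ha.ergodicCoeff⟩
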